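/- For real $u>0$ let $\zeta(s,u)$ denote the Hurwitz zeta function, i.e. the analytic continuation to $s\in\mathbb{C}\setminus\{1\}$ of $\sum_{n=0}^\infty (n+u)^{-s}$ ($\operatorname{Re} s>1$), and let the generalised Stieltjes constants $\gamma_p(u)$ be defined by its Laurent expansion about $s=1$, $$\zeta(s,u)=\frac{1}{s-1}+\sum_{p=0}^\infty \frac{(-1)^p}{p!}\,\gamma_p(u)\,(s-1)^p .$$ Then for every $u>0$ both integrals below converge absolutely, and $$\gamma_1(u)=\frac{1}{2u}\log u-\frac12\log^2 u+\int_0^\infty \frac{x\log(u^2+x^2)}{(u^2+x^2)(e^{2\pi x}-1)}\,dx-2u\int_0^\infty \frac{\arctan(x/u)}{(u^2+x^2)(e^{2\pi x}-1)}\,dx .$$ -/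

import Mathlib

open Filter Topology

/-- The Hurwitz zeta function `ζ(s, u)` for a real parameter `u > 0`: the analytic continuation to
`s ≠ 1` of `∑_{n ≥ 0} 1 / (n + u) ^ s`.

Mathlib's `HurwitzZeta.hurwitzZeta` takes its parameter modulo `1`, and is the continuation of
`∑_{n ≥ 0} 1 / (n + a) ^ s` for the representative `a = u - N` in `(0, 1]`, where
`N = ⌈u⌉ - 1`. The series with parameter `u` is obtained by removing the first `N` terms. -/
noncomputable def hurwitzZetaPos (s : ℂ) (u : ℝ) : ℂ :=
  HurwitzZeta.hurwitzZeta (u : UnitAddCircle) s -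
    ∑ k ∈ Finset.range (⌈u⌉₊ - 1), 1 / ((k : ℂ) + ((u - ((⌈u⌉₊ - 1 : ℕ) : ℝ) : ℝ) : ℂ)) ^ s

/-- The function `ζ(s, u) - 1 / (s - 1)` of `s`, with the removable singularity at `s = 1`
filled in by the limit there. -/
noncomputable def hurwitzZetaRegular (u : ℝ) : ℂ → ℂ :=
  Function.update (fun s : ℂ => hurwitzZetaPos s u - 1 / (s - 1)) 1
    (limUnder (𝓝[≠] (1 : ℂ)) fun s : ℂ => hurwitzZetaPos s u - 1 / (s - 1))

/-- The generalised Stieltjes constants `γ_p(u)`: the coefficients in the Laurent expansion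
`ζ(s, u) = 1 / (s - 1) + ∑_{p ≥ 0} (-1) ^ p / p! * γ_p(u) * (s - 1) ^ p` about `s = 1`. -/
noncomputable def stieltjesGamma (p : ℕ) (u : ℝ) : ℂ :=
  (-1) ^ p * iteratedDeriv p (hurwitzZetaRegular u) 1

/-- On `1 < re s`, `hurwitzZetaPos` is the sum of the Hurwitz series. -/
theorem hasSum_hurwitzZetaPos {u : ℝ} (hu : 0 < u) {s : ℂ} (hs : 1 < s.re) :
    HasSum (fun n : ℕ => 1 / ((n : ℂ) + (u : ℂ)) ^ s) (hurwitzZetaPos s u) := by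
  have h1 : 1 ≤ ⌈u⌉₊ := Nat.one_le_iff_ne_zero.mpr (Nat.ceil_pos.mpr hu).ne'
  have h2 : (((⌈u⌉₊ - 1 : ℕ) : ℝ)) = (⌈u⌉₊ : ℝ) - 1 := by push_cast [h1]; rfl
  have h3 := Nat.le_ceil u
  have h4 := Nat.ceil_lt_add_one hu.le
  unfold hurwitzZetaPos
  generalize (⌈u⌉₊ - 1 : ℕ) = N at *
  have hmem : u - (N : ℝ) ∈ Set.Icc (0 : ℝ) 1 := ⟨by linarith, by linarith⟩
  have hcirc : ((u - (N : ℝ) : ℝ) : UnitAddCircle) = (u : UnitAddCircle) := by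
    rw [AddCircle.coe_sub, sub_eq_self, AddCircle.coe_eq_zero_iff]
    exact ⟨N, by simp⟩
  have h := HurwitzZeta.hasSum_hurwitzZeta_of_one_lt_re hmem hs
  rw [hcirc, ← hasSum_nat_add_iff' N] at h
  have hf : (fun n : ℕ => 1 / ((n : ℂ) + (u : ℂ)) ^ s) =
      fun n : ℕ => 1 / (((n + N : ℕ) : ℂ) + ((u - (N : ℝ) : ℝ) : ℂ)) ^ s := by
    funext n
    have : ((n + N : ℕ) : ℂ) + ((u - (N : ℝ) : ℝ) : ℂ) = (n : ℂ) + (u : ℂ) := by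
      push_cast
      ring
    rw [this]
  rw [hf]
  exact h

/-- The finitely many terms removed in `hurwitzZetaPos` are entire. -/
theorem differentiable_hurwitzZetaPos_head {u : ℝ} (hu : 0 < u) :
    Differentiable ℂ fun s : ℂ => ∑ k ∈ Finset.range (⌈u⌉₊ - 1),
      1 / ((k : ℂ) + ((u - ((⌈u⌉₊ - 1 : ℕ) : ℝ) : ℝ) : ℂ)) ^ s := by
  have h1 : 1 ≤ ⌈u⌉₊ := Nat.one_le_iff_ne_zero.mpr (Nat.ceil_pos.mpr hu).ne'
  have h2 : (((⌈u⌉₊ - 1 : ℕ) : ℝ)) = (⌈u⌉₊ : ℝ) - 1 := by push_cast [h1]; rfl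
  have h4 := Nat.ceil_lt_add_one hu.le
  generalize (⌈u⌉₊ - 1 : ℕ) = N at *
  refine fun s => DifferentiableAt.fun_sum fun k _ => ?_
  have hpos : (0 : ℝ) < (k : ℝ) + (u - N) := by
    have : (0 : ℝ) ≤ k := Nat.cast_nonneg k
    linarith
  have hne : (k : ℂ) + ((u - (N : ℝ) : ℝ) : ℂ) ≠ 0 := by exact_mod_cast hpos.ne'
  refine (differentiableAt_const _).div (differentiableAt_id.const_cpow (Or.inl hne)) ?_
  exact fun h0 => hne ((Complex.cpow_eq_zero_iff _ _).mp h0).1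

/-- `hurwitzZetaPos` is holomorphic away from `s = 1`. -/
theorem differentiableAt_hurwitzZetaPos {u : ℝ} (hu : 0 < u) {s : ℂ} (hs : s ≠ 1) :
    DifferentiableAt ℂ (fun z : ℂ => hurwitzZetaPos z u) s :=
  (HurwitzZeta.differentiableAt_hurwitzZeta _ hs).sub (differentiable_hurwitzZetaPos_head hu s)

/-- `hurwitzZetaRegular` is entire. -/
theorem differentiable_hurwitzZetaRegular {u : ℝ} (hu : 0 < u) :
    Differentiable ℂ (hurwitzZetaRegular u) := by
  have hcont : Tendsto (fun s : ℂ => (s - 1) * ∑ k ∈ Finset.range (⌈u⌉₊ - 1),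
      1 / ((k : ℂ) + ((u - ((⌈u⌉₊ - 1 : ℕ) : ℝ) : ℝ) : ℂ)) ^ s) (𝓝[≠] 1) (𝓝 0) := by
    have hd := (differentiable_hurwitzZetaPos_head hu).continuous
    have hc : Continuous fun s : ℂ => (s - 1) * ∑ k ∈ Finset.range (⌈u⌉₊ - 1),
        1 / ((k : ℂ) + ((u - ((⌈u⌉₊ - 1 : ℕ) : ℝ) : ℝ) : ℂ)) ^ s :=
      (continuous_id.sub continuous_const).mul hd
    have := hc.tendsto 1
    rw [sub_self, zero_mul] at this
    exact this.mono_left nhdsWithin_le_nhds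
  have hid : Tendsto (fun s : ℂ => s - 1) (𝓝[≠] 1) (𝓝 0) := by
    have : Tendsto (fun s : ℂ => s - 1) (𝓝 1) (𝓝 (1 - 1)) := tendsto_id.sub_const 1
    rw [sub_self] at this
    exact this.mono_left nhdsWithin_le_nhds
  rw [← differentiableOn_univ]
  refine Complex.differentiableOn_update_limUnder_of_isLittleO univ_mem ?_ ?_
  · intro z hz
    have hz1 : z ≠ 1 := by simpa using hz
    refine DifferentiableAt.differentiableWithinAt ?_
    refine (differentiableAt_hurwitzZetaPos hu hz1).sub ?_
    exact (differentiableAt_const _).div (differentiableAt_id.sub_const 1) (sub_ne_zero.mpr hz1)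
  · have hne : ∀ᶠ z : ℂ in 𝓝[≠] 1, (z - 1)⁻¹ = 0 →
        (hurwitzZetaPos z u - 1 / (z - 1)) - (hurwitzZetaPos 1 u - 1 / ((1 : ℂ) - 1)) = 0 := by
      filter_upwards [self_mem_nhdsWithin] with z hz h0
      exact absurd (inv_eq_zero.mp h0) (sub_ne_zero.mpr hz)
    rw [Asymptotics.isLittleO_iff_tendsto' hne]
    have hlim := (((HurwitzZeta.hurwitzZeta_residue_one (u : UnitAddCircle)).sub hcont).sub_const
      1).sub (hid.mul_const (hurwitzZetaPos 1 u - 1 / ((1 : ℂ) - 1)))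
    rw [show (1 : ℂ) - 0 - 1 - 0 * (hurwitzZetaPos 1 u - 1 / ((1 : ℂ) - 1)) = 0 by ring] at hlim
    refine hlim.congr' ?_
    filter_upwards [self_mem_nhdsWithin] with z hz
    have hz' : z - 1 ≠ 0 := sub_ne_zero.mpr hz
    generalize hurwitzZetaPos 1 u - 1 / ((1 : ℂ) - 1) = c
    unfold hurwitzZetaPos
    field_simp

/-- The Laurent expansion of the Hurwitz zeta function about `s = 1`. -/
theorem hasSum_stieltjesGamma {u : ℝ} (hu : 0 < u) {s : ℂ} (hs : s ≠ 1) :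
    HasSum (fun p : ℕ => (-1) ^ p / (p.factorial : ℂ) * stieltjesGamma p u * (s - 1) ^ p)
      (hurwitzZetaPos s u - 1 / (s - 1)) := by
  have h := Complex.hasSum_taylorSeries_of_entire (differentiable_hurwitzZetaRegular hu) 1 s
  have e : hurwitzZetaRegular u s = hurwitzZetaPos s u - 1 / (s - 1) := by
    simp [hurwitzZetaRegular, hs]
  rw [e] at h
  have hf : (fun p : ℕ => (-1) ^ p / (p.factorial : ℂ) * stieltjesGamma p u * (s - 1) ^ p) =
      fun p : ℕ => (p.factorial : ℂ)⁻¹ • (s - 1) ^ p • iteratedDeriv p (hurwitzZetaRegular u) 1 := by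
    funext p
    have hp : ((-1 : ℂ) ^ p) * (-1) ^ p = 1 := by rw [← mul_pow]; simp
    simp only [stieltjesGamma, smul_eq_mul, div_eq_mul_inv]
    linear_combination ((p.factorial : ℂ)⁻¹ * iteratedDeriv p (hurwitzZetaRegular u) 1 *
      (s - 1) ^ p) * hp
  rw [hf]
  exact h

/-! The formula is minus the derivative at `s = 1` of Hermite's formula, valid for real `s > 1`:
`ζ(s,u) = u^(-s)/2 + u^(1-s)/(s-1) + 2 ∫ sin(s arctan(x/u)) / ((u²+x²)^(s/2) (e^(2πx)-1)) dx`.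

Hermite's formula (`hurwitzZetaPos_eq_hermite`) comes from the Mellin integral `ζ(s,u) Γ(s) = ∫
y^(s-1) e^(-uy) (1/(e^y-1) + 1) dy`. The sine transform `integral_sin_div_exp_sub_one` replaces the
last factor by `1/2 + 1/y + 2 ∫ sin(xy)/(e^(2πx)-1) dx`. After Fubini the inner integral over `y` is
`Γ(s) Im (u-ix)^(-s)`.

Subtracting `1/(s-1)` leaves `(u^(1-s)-1)/(s-1)`, smooth at `1` with derivative `(log u)²/2`; the
integral is differentiated under its sign. Real `s > 1` suffices: both sides are differentiable at
`1`, so agreement to the right of `1` forces equal derivatives. -/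

/-! ### Integrability against the weight `1/(e^(2πx)-1)` -/

/-- With `E = e^(πx)`: `x ≤ πx ≤ E - 1 ≤ E - E⁻¹ = E⁻¹ (E² - 1)`. The factor `x` absorbs the pole of
the weight at `0`. -/
theorem div_exp_sub_one_le {x : ℝ} (hx : 0 < x) :
    x / (Real.exp (2 * Real.pi * x) - 1) ≤ Real.exp (-Real.pi * x) := by
  have hpi := Real.pi_gt_three
  have hE : Real.exp (2 * Real.pi * x) = Real.exp (Real.pi * x) * Real.exp (Real.pi * x) := by
    rw [← Real.exp_add]; ring_nf
  have h1 : 1 + Real.pi * x ≤ Real.exp (Real.pi * x) := by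
    have := Real.add_one_le_exp (Real.pi * x); linarith
  have hpx : 0 < Real.pi * x := by positivity
  have hx' : x ≤ Real.pi * x := by nlinarith
  have hmul : Real.exp (-Real.pi * x) * Real.exp (Real.pi * x) = 1 := by
    rw [← Real.exp_add]; simp
  have hle : Real.exp (-Real.pi * x) ≤ 1 := Real.exp_le_one_iff.mpr (by linarith)
  rw [div_le_iff₀ (by rw [hE]; nlinarith)]
  calc x ≤ Real.exp (Real.pi * x) - 1 := by linarith
    _ ≤ Real.exp (Real.pi * x) - Real.exp (-Real.pi * x) := by linarith
    _ = Real.exp (-Real.pi * x) * (Real.exp (2 * Real.pi * x) - 1) := by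
      rw [hE]; linear_combination (-Real.exp (Real.pi * x)) * hmul

theorem exp_two_pi_mul_sub_one_pos {x : ℝ} (hx : 0 < x) :
    0 < Real.exp (2 * Real.pi * x) - 1 :=
  sub_pos.mpr (Real.one_lt_exp_iff.mpr (by positivity))

theorem integrableOn_pow_mul_exp_neg_mul (n : ℕ) {b : ℝ} (hb : 0 < b) :
    MeasureTheory.IntegrableOn (fun x : ℝ => x ^ n * Real.exp (-b * x)) (Set.Ioi 0) := by
  have h := integrableOn_rpow_mul_exp_neg_mul_rpow (p := 1) (s := n) (b := b)
    (by have : (0 : ℝ) ≤ n := n.cast_nonneg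
        linarith) one_pos hb
  simpa using h

theorem integrableOn_rpow_mul_exp_neg_mul {s b : ℝ} (hs : -1 < s) (hb : 0 < b) :
    MeasureTheory.IntegrableOn (fun x : ℝ => x ^ s * Real.exp (-b * x)) (Set.Ioi 0) := by
  have h := integrableOn_rpow_mul_exp_neg_mul_rpow (p := 1) hs one_pos hb
  simpa using h

/-- A function dominated by a multiple of `x (1 + x)` is integrable against
`1 / (exp (2 π x) - 1)`. -/
theorem integrableOn_div_exp_sub_one {f : ℝ → ℝ} (hf : Measurable f) {C : ℝ}
    (hC : ∀ x, 0 < x → |f x| ≤ C * (x * (1 + x))) :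
    MeasureTheory.IntegrableOn (fun x => f x / (Real.exp (2 * Real.pi * x) - 1)) (Set.Ioi 0) := by
  have hpi := Real.pi_pos
  have hg := ((integrableOn_pow_mul_exp_neg_mul 0 hpi).add
    (integrableOn_pow_mul_exp_neg_mul 1 hpi)).const_mul C
  refine MeasureTheory.Integrable.mono' hg
    (hf.div (by fun_prop : Measurable fun x : ℝ =>
      Real.exp (2 * Real.pi * x) - 1)).aestronglyMeasurable ?_
  filter_upwards [MeasureTheory.ae_restrict_mem measurableSet_Ioi] with x hx
  have hx : 0 < x := hx
  have hE := exp_two_pi_mul_sub_one_pos hx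
  have hCn : 0 ≤ C := by
    have := (abs_nonneg _).trans (hC x hx)
    exact nonneg_of_mul_nonneg_left this (by positivity)
  rw [Real.norm_eq_abs, abs_div, abs_of_pos hE]
  calc |f x| / (Real.exp (2 * Real.pi * x) - 1)
      ≤ C * (x * (1 + x)) / (Real.exp (2 * Real.pi * x) - 1) := by gcongr; exact hC x hx
    _ = C * (1 + x) * (x / (Real.exp (2 * Real.pi * x) - 1)) := by ring
    _ ≤ C * (1 + x) * Real.exp (-Real.pi * x) := by gcongr; exact div_exp_sub_one_le hx
    _ = _ := by simp only [Pi.add_apply]; ring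

/-! ### The sine transform of the weight -/

theorem integral_sin_mul_exp_neg_mul {b : ℝ} (hb : 0 < b) (y : ℝ) :
    ∫ x in Set.Ioi (0 : ℝ), Real.sin (x * y) * Real.exp (-b * x) = y / (b ^ 2 + y ^ 2) := by
  have ha : ((-b : ℝ) + (y : ℝ) * Complex.I : ℂ).re < 0 := by simpa using hb
  have h := integral_exp_mul_complex_Ioi ha 0
  have hi := integrableOn_exp_mul_complex_Ioi ha 0
  have h2 := congrArg Complex.im h
  rw [← RCLike.im_to_complex, ← integral_im hi] at h2
  have e : ∀ x : ℝ, RCLike.im (Complex.exp (((-b : ℝ) + (y : ℝ) * Complex.I : ℂ) * x)) =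
      Real.sin (x * y) * Real.exp (-b * x) := by
    intro x
    rw [RCLike.im_to_complex, Complex.exp_im]
    simp [mul_comm]
  simp_rw [e] at h2
  rw [h2, Complex.ofReal_zero, mul_zero, Complex.exp_zero, neg_div, one_div,
    Complex.neg_im, Complex.inv_im]
  simp [Complex.normSq_apply, neg_div, sq]

theorem hasSum_exp_neg_mul {x : ℝ} (hx : 0 < x) :
    HasSum (fun n : ℕ => Real.exp (-(2 * Real.pi * (n + 1)) * x))
      (1 / (Real.exp (2 * Real.pi * x) - 1)) := by
  have hE := exp_two_pi_mul_sub_one_pos hx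
  have hr : Real.exp (-(2 * Real.pi * x)) < 1 := Real.exp_lt_one_iff.mpr (by
    have : 0 < 2 * Real.pi * x := by positivity
    linarith)
  have h := (hasSum_geometric_of_lt_one (Real.exp_pos _).le hr).mul_left
    (Real.exp (-(2 * Real.pi * x)))
  convert! h using 1
  · funext n
    rw [← Real.exp_nat_mul, ← Real.exp_add]
    ring_nf
  · rw [Real.exp_neg]
    field_simp

/-- The partial fraction series of `π cot(πz)` at `z = iy/(2π)`, where the cotangent is a ratio of
real exponentials. -/
theorem hasSum_partialFractions_exp {y : ℝ} (hy : 0 < y) :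
    HasSum (fun n : ℕ => y / ((2 * Real.pi * (n + 1)) ^ 2 + y ^ 2))
      ((1 / (Real.exp y - 1) - 1 / y + 1 / 2) / 2) := by
  have hpi := Real.pi_pos
  set z : ℂ := ((y / (2 * Real.pi) : ℝ) : ℂ) * Complex.I with hz
  have hzim : z.im = y / (2 * Real.pi) := by
    rw [hz, Complex.im_ofReal_mul, Complex.I_im, mul_one]
  have hz0 : z.im ≠ 0 := by rw [hzim]; positivity
  have hmem : z ∈ Complex.integerComplement := by
    rintro ⟨n, hn⟩
    exact hz0 (by rw [← hn, Complex.intCast_im])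
  have hs := (summable_cotTerm hmem).hasSum
  have hcot : ∑' n : ℕ, cotTerm z n = Real.pi * Complex.cot (Real.pi * z) - 1 / z := by
    rw [cot_series_rep' hmem]
  rw [hcot, Complex.cot_pi_eq_exp_ratio] at hs
  have hexp : Complex.exp (2 * Real.pi * Complex.I * z) = ((Real.exp (-y) : ℝ) : ℂ) := by
    rw [Complex.ofReal_exp, hz]
    congr 1
    have : (Real.pi : ℂ) ≠ 0 := by exact_mod_cast hpi.ne'
    push_cast
    field_simp
    rw [Complex.I_sq, neg_one_mul]
  rw [hexp] at hs
  -- This factor turns `2z/(z² - (n+1)²)` into `y/((2π(n+1))² + y²)`.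
  have h2 := hs.mul_left (Complex.I / (4 * Real.pi))
  have hpc : (Real.pi : ℂ) ≠ 0 := by exact_mod_cast hpi.ne'
  have hyc : (y : ℂ) ≠ 0 := by exact_mod_cast hy.ne'
  have hey : (1 : ℝ) < Real.exp y := Real.one_lt_exp_iff.mpr hy
  rw [← Complex.hasSum_ofReal]
  convert! h2 using 1
  · funext n
    rw [cotTerm_identity hmem]
    have hd : ((2 * Real.pi * (n + 1)) ^ 2 + y ^ 2 : ℝ) ≠ 0 := by positivity
    have hd' : ((2 * Real.pi * (n + 1)) ^ 2 + y ^ 2 : ℂ) ≠ 0 := by exact_mod_cast hd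
    have e : (z + (n + 1)) * (z - (n + 1)) =
        -((2 * Real.pi * (n + 1)) ^ 2 + y ^ 2 : ℂ) / (4 * Real.pi ^ 2) := by
      rw [hz]; push_cast; field_simp; ring_nf; simp only [Complex.I_sq]; ring
    rw [e, hz]
    push_cast
    field_simp
    rw [Complex.I_sq]; ring
  · have h1 : ((Real.exp y : ℝ) : ℂ) - 1 ≠ 0 := by
      exact_mod_cast (sub_pos.mpr hey).ne'
    have h0 : ((Real.exp y : ℝ) : ℂ) ≠ 0 := by exact_mod_cast (Real.exp_pos y).ne'
    rw [hz, Real.exp_neg]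
    push_cast at h0 h1 ⊢
    have h3 : (1 : ℂ) - (Complex.exp y)⁻¹ ≠ 0 := by
      intro h; apply h1; field_simp at h; rw [h, mul_zero]
    field_simp
    ring

/-- The sine transform of `1 / (exp (2 π x) - 1)`. -/
theorem integral_sin_div_exp_sub_one {y : ℝ} (hy : 0 < y) :
    2 * ∫ x in Set.Ioi (0 : ℝ), Real.sin (x * y) / (Real.exp (2 * Real.pi * x) - 1) =
      1 / (Real.exp y - 1) - 1 / y + 1 / 2 := by
  have hpi := Real.pi_pos
  have hb : ∀ n : ℕ, 0 < 2 * Real.pi * ((n : ℝ) + 1) := fun n => by positivity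
  have hint : ∀ n : ℕ, MeasureTheory.IntegrableOn
      (fun x : ℝ => Real.sin (x * y) * Real.exp (-(2 * Real.pi * (n + 1)) * x)) (Set.Ioi 0) := by
    intro n
    refine MeasureTheory.Integrable.mono' (integrableOn_pow_mul_exp_neg_mul 0 (hb n))
      (by fun_prop) (Eventually.of_forall fun x => ?_)
    rw [norm_mul, Real.norm_eq_abs, Real.norm_eq_abs, Real.abs_exp, pow_zero]
    gcongr
    exact Real.abs_sin_le_one _
  -- Using `|sin(xy)| ≤ xy` gains a second power of `n+1`; the bound `|sin| ≤ 1` would only give a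
  -- harmonic series.
  have hnorm : ∀ n : ℕ, ∫ x in Set.Ioi (0 : ℝ),
      ‖Real.sin (x * y) * Real.exp (-(2 * Real.pi * (n + 1)) * x)‖ ≤
        y * (1 / (n + 1 : ℕ) ^ 2) := by
    intro n
    have hG : ∫ x in Set.Ioi (0 : ℝ), y * (x ^ 1 * Real.exp (-(2 * Real.pi * (n + 1)) * x)) =
        y * (1 / (2 * Real.pi * (n + 1)) ^ 2) := by
      rw [MeasureTheory.integral_const_mul]
      have := Real.integral_rpow_mul_exp_neg_mul_Ioi (a := 2) two_pos (hb n)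
      rw [show (2 : ℝ) - 1 = 1 by norm_num, Real.Gamma_two, mul_one] at this
      simp_rw [Real.rpow_one, Real.rpow_two] at this
      simp_rw [pow_one, neg_mul, this, div_pow, one_pow]
    calc _ ≤ ∫ x in Set.Ioi (0 : ℝ), y * (x ^ 1 * Real.exp (-(2 * Real.pi * (n + 1)) * x)) := by
          refine MeasureTheory.setIntegral_mono_on (hint n).norm
            ((integrableOn_pow_mul_exp_neg_mul 1 (hb n)).const_mul y) measurableSet_Ioi ?_
          intro x hx
          have hx : 0 < x := hx
          rw [norm_mul, Real.norm_eq_abs, Real.norm_eq_abs, Real.abs_exp, ← mul_assoc]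
          gcongr
          refine (Real.abs_sin_le_abs).trans ?_
          rw [abs_of_pos (by positivity)]; linarith
      _ = y * (1 / (2 * Real.pi * (n + 1)) ^ 2) := hG
      _ ≤ _ := by
          push_cast
          gcongr
          have := Real.pi_gt_three
          have h0 : (0 : ℝ) < (n : ℝ) + 1 := by positivity
          nlinarith
  have hsum : Summable fun n : ℕ => ∫ x in Set.Ioi (0 : ℝ),
      ‖Real.sin (x * y) * Real.exp (-(2 * Real.pi * (n + 1)) * x)‖ := by
    refine Summable.of_nonneg_of_le
      (fun n => MeasureTheory.integral_nonneg fun x => norm_nonneg _) hnorm ?_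
    have := (summable_nat_add_iff 1).mpr (Real.summable_one_div_nat_pow.mpr one_lt_two)
    exact this.mul_left y
  have h := MeasureTheory.hasSum_integral_of_summable_integral_norm hint hsum
  simp_rw [integral_sin_mul_exp_neg_mul (hb _)] at h
  have h' := h.unique (hasSum_partialFractions_exp hy)
  have hcongr : ∫ x in Set.Ioi (0 : ℝ), Real.sin (x * y) / (Real.exp (2 * Real.pi * x) - 1) =
      ∫ x in Set.Ioi (0 : ℝ),
        ∑' n : ℕ, Real.sin (x * y) * Real.exp (-(2 * Real.pi * (n + 1)) * x) := by
    refine MeasureTheory.setIntegral_congr_fun measurableSet_Ioi fun x hx => ?_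
    have := ((hasSum_exp_neg_mul hx).mul_left (Real.sin (x * y))).tsum_eq
    rw [this, mul_one_div]
  rw [hcongr, h']
  ring

/-! ### Laplace transforms of `t^(s-1)` and `t^(s-1) sin(xt)` -/

theorem integrableOn_rpow_mul_cexp_neg_mul {s : ℝ} (hs : 0 < s) {w : ℂ} (hw : 0 < w.re) :
    MeasureTheory.IntegrableOn (fun t : ℝ => ((t ^ (s - 1) : ℝ) : ℂ) * Complex.exp (-w * t))
      (Set.Ioi 0) := by
  refine MeasureTheory.Integrable.mono'
    (integrableOn_rpow_mul_exp_neg_mul (s := s - 1) (by linarith) hw)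
    (by fun_prop) ?_
  filter_upwards [MeasureTheory.ae_restrict_mem measurableSet_Ioi] with t ht
  rw [norm_mul, Complex.norm_exp, Complex.norm_real,
    Real.norm_of_nonneg (Real.rpow_nonneg (le_of_lt ht) _)]
  simp

theorem differentiableAt_integral_rpow_mul_cexp_neg_mul {s : ℝ} (hs : 0 < s) {w : ℂ}
    (hw : 0 < w.re) :
    DifferentiableAt ℂ (fun w : ℂ => ∫ t in Set.Ioi (0 : ℝ),
      ((t ^ (s - 1) : ℝ) : ℂ) * Complex.exp (-w * t)) w := by
  -- On this ball the derivative of the integrand is dominated by `t^s e^(-(Re w/2)t)`.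
  have hre : ∀ z ∈ Metric.ball w (w.re / 2), w.re / 2 < z.re := by
    intro z hz
    have h1 := (Complex.abs_re_le_norm (z - w)).trans_lt (mem_ball_iff_norm.mp hz)
    rw [Complex.sub_re, abs_lt] at h1
    linarith [h1.1]
  refine (hasDerivAt_integral_of_dominated_loc_of_deriv_le
    (F := fun z (t : ℝ) => ((t ^ (s - 1) : ℝ) : ℂ) * Complex.exp (-z * t))
    (F' := fun z t => ((t ^ (s - 1) : ℝ) : ℂ) * (Complex.exp (-z * t) * (-1 * t)))
    (Metric.ball_mem_nhds w (half_pos hw)) (Eventually.of_forall fun z => by fun_prop)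
    (integrableOn_rpow_mul_cexp_neg_mul hs hw) (by fun_prop) ?_
    (integrableOn_rpow_mul_exp_neg_mul (s := s) (by linarith) (half_pos hw)) ?_).2.differentiableAt
  · filter_upwards [MeasureTheory.ae_restrict_mem measurableSet_Ioi] with t ht z hz
    have ht : 0 < t := ht
    rw [norm_mul, norm_mul, Complex.norm_exp, Complex.norm_real,
      Real.norm_of_nonneg (Real.rpow_nonneg ht.le _), norm_mul, norm_neg, norm_one, one_mul,
      Complex.norm_real, Real.norm_of_nonneg ht.le]
    have e : t ^ s = t ^ (s - 1) * t := by
      rw [← Real.rpow_add_one ht.ne']; ring_nf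
    have hle : Real.exp ((-z * t).re) ≤ Real.exp (-(w.re / 2) * t) := by
      rw [Real.exp_le_exp, Complex.re_mul_ofReal, Complex.neg_re]
      nlinarith [hre z hz]
    rw [e, mul_assoc, mul_comm t]
    gcongr
  · refine Eventually.of_forall fun t z _ => ?_
    exact ((((hasDerivAt_id z).neg.mul_const (t : ℂ)).cexp).const_mul _)

/-- The Laplace transform of `t ^ (s - 1)` on the right half plane. -/
theorem integral_rpow_mul_cexp_neg_mul {s : ℝ} (hs : 0 < s) {w : ℂ} (hw : 0 < w.re) :
    ∫ t in Set.Ioi (0 : ℝ), ((t ^ (s - 1) : ℝ) : ℂ) * Complex.exp (-w * t) =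
      w ^ (-(s : ℂ)) * (Real.Gamma s : ℂ) := by
  have hopen : IsOpen {w : ℂ | 0 < w.re} := isOpen_lt continuous_const Complex.continuous_re
  have h1 : AnalyticOnNhd ℂ (fun w : ℂ => ∫ t in Set.Ioi (0 : ℝ),
      ((t ^ (s - 1) : ℝ) : ℂ) * Complex.exp (-w * t)) {w : ℂ | 0 < w.re} :=
    DifferentiableOn.analyticOnNhd (fun z hz =>
      (differentiableAt_integral_rpow_mul_cexp_neg_mul hs hz).differentiableWithinAt) hopen
  have h2 : AnalyticOnNhd ℂ (fun w : ℂ => w ^ (-(s : ℂ)) * (Real.Gamma s : ℂ))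
      {w : ℂ | 0 < w.re} :=
    DifferentiableOn.analyticOnNhd (fun z hz =>
      ((differentiableAt_id.cpow_const (Or.inl hz)).mul_const _).differentiableWithinAt) hopen
  -- Identity theorem: both sides are analytic on the half plane, and for positive real `w` they
  -- agree by Euler's Gamma integral.
  refine AnalyticOnNhd.eqOn_of_preconnected_of_frequently_eq h1 h2
    (convex_halfSpace_re_gt 0).isPreconnected (z₀ := ((1 : ℝ) : ℂ)) (by simp) ?_ hw
  have ht : Tendsto (fun x : ℝ => (x : ℂ)) (𝓝[≠] 1) (𝓝[≠] ((1 : ℝ) : ℂ)) :=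
    tendsto_nhdsWithin_iff.mpr ⟨(Complex.continuous_ofReal.tendsto 1).mono_left nhdsWithin_le_nhds,
      eventually_mem_nhdsWithin.mono fun x hx => by simpa using hx⟩
  refine ht.frequently (Eventually.frequently ?_)
  filter_upwards [nhdsWithin_le_nhds (lt_mem_nhds (one_pos : (0 : ℝ) < 1))] with r hr
  have h := Real.integral_rpow_mul_exp_neg_mul_Ioi hs hr
  have e : ∀ t : ℝ, ((t ^ (s - 1) : ℝ) : ℂ) * Complex.exp (-(r : ℂ) * t) =
      ((t ^ (s - 1) * Real.exp (-(r * t)) : ℝ) : ℂ) := by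
    intro t; push_cast; rw [neg_mul]
  simp_rw [e]
  rw [integral_complex_ofReal, h, one_div, Real.inv_rpow hr.le, ← Real.rpow_neg hr.le]
  push_cast
  rw [Complex.ofReal_cpow hr.le]
  push_cast
  rfl

theorem arg_sub_mul_I {u : ℝ} (hu : 0 < u) (x : ℝ) :
    Complex.arg ((u : ℂ) - x * Complex.I) = -Real.arctan (x / u) := by
  have hre : ((u : ℂ) - x * Complex.I).re = u := by simp
  have him : ((u : ℂ) - x * Complex.I).im = -x := by simp
  have h := Complex.abs_arg_lt_pi_div_two_iff.mpr
    (Or.inl (by rw [hre]; exact hu) : 0 < ((u : ℂ) - x * Complex.I).re ∨ _)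
  rw [abs_lt] at h
  rw [← Real.arctan_tan h.1 h.2, Complex.tan_arg, hre, him, neg_div, Real.arctan_neg]

/-- Since `u > 0`, the principal logarithm of `u - ix` is `log(u²+x²)/2 - i arctan(x/u)`. -/
theorem im_sub_mul_I_cpow_neg {u : ℝ} (hu : 0 < u) (x s : ℝ) :
    (((u : ℂ) - x * Complex.I) ^ (-(s : ℂ))).im =
      Real.exp (-(s / 2) * Real.log (u ^ 2 + x ^ 2)) * Real.sin (s * Real.arctan (x / u)) := by
  have hne : (u : ℂ) - x * Complex.I ≠ 0 := by
    intro h; have := congrArg Complex.re h; simp at this; exact hu.ne' this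
  have hn : ‖(u : ℂ) - x * Complex.I‖ = Real.sqrt (u ^ 2 + x ^ 2) := by
    rw [Complex.norm_def, Complex.normSq_apply]; congr 1; simp; ring
  have hlog : Complex.log ((u : ℂ) - x * Complex.I) =
      ((Real.log (u ^ 2 + x ^ 2) / 2 : ℝ) : ℂ) - (Real.arctan (x / u) : ℝ) * Complex.I := by
    rw [Complex.log, hn, arg_sub_mul_I hu, Real.log_sqrt (by positivity)]
    push_cast; ring
  rw [Complex.cpow_def_of_ne_zero hne, hlog, ← Complex.ofReal_neg, Complex.exp_im]
  generalize Real.arctan (x / u) = θ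
  congr 2
  · simp; ring
  · simp [mul_comm]

/-- The Laplace transform of `t ^ (s - 1) * sin (x * t)`. -/
theorem integral_rpow_mul_exp_neg_mul_sin {s u : ℝ} (hs : 0 < s) (hu : 0 < u) (x : ℝ) :
    ∫ t in Set.Ioi (0 : ℝ), t ^ (s - 1) * Real.exp (-u * t) * Real.sin (x * t) =
      Real.exp (-(s / 2) * Real.log (u ^ 2 + x ^ 2)) * Real.sin (s * Real.arctan (x / u)) *
        Real.Gamma s := by
  have hw : 0 < ((u : ℂ) - x * Complex.I).re := by simpa using hu
  have h := congrArg Complex.im (integral_rpow_mul_cexp_neg_mul hs hw)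
  rw [Complex.im_mul_ofReal, im_sub_mul_I_cpow_neg hu, ← RCLike.im_to_complex,
    ← integral_im (integrableOn_rpow_mul_cexp_neg_mul hs hw)] at h
  rw [← h]
  congr 1
  funext t
  rw [RCLike.im_to_complex, Complex.im_ofReal_mul, Complex.exp_im]
  simp [mul_assoc]

/-! ### Mellin representation and Hermite's formula -/

theorem hasSum_rpow_hurwitzZetaPos {u s : ℝ} (hu : 0 < u) (hs : 1 < s) :
    HasSum (fun n : ℕ => (((1 / ((n : ℝ) + u)) ^ s : ℝ) : ℂ)) (hurwitzZetaPos s u) := by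
  convert! hasSum_hurwitzZetaPos hu (s := (s : ℂ)) (by simpa using hs) using 1
  funext n
  have hn : 0 ≤ (n : ℝ) + u := by positivity
  rw [Real.div_rpow zero_le_one hn, Real.one_rpow, Complex.ofReal_div, Complex.ofReal_cpow hn]
  push_cast
  rfl

/-- The Mellin transform representation of the Hurwitz zeta function. -/
theorem hurwitzZetaPos_mul_Gamma {u s : ℝ} (hu : 0 < u) (hs : 1 < s) :
    hurwitzZetaPos s u * (Real.Gamma s : ℂ) =
      ((∫ y in Set.Ioi (0 : ℝ),
        y ^ (s - 1) * Real.exp (-u * y) * (1 / (Real.exp y - 1) + 1) : ℝ) : ℂ) := by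
  have hc := hasSum_rpow_hurwitzZetaPos hu hs
  have hsum : Summable fun n : ℕ => (1 / ((n : ℝ) + u)) ^ s * Real.Gamma s :=
    (Complex.summable_ofReal.mp hc.summable).mul_right _
  have hb : ∀ n : ℕ, 0 < (n : ℝ) + u := fun n => by positivity
  have hs0 : 0 < s := by linarith
  have hval : ∀ n : ℕ, ∫ y in Set.Ioi (0 : ℝ), y ^ (s - 1) * Real.exp (-((n : ℝ) + u) * y) =
      (1 / ((n : ℝ) + u)) ^ s * Real.Gamma s := by
    intro n
    rw [← Real.integral_rpow_mul_exp_neg_mul_Ioi hs0 (hb n)]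
    simp_rw [neg_mul]
  have hnorm : ∀ n : ℕ, ∫ y in Set.Ioi (0 : ℝ), ‖y ^ (s - 1) * Real.exp (-((n : ℝ) + u) * y)‖ =
      (1 / ((n : ℝ) + u)) ^ s * Real.Gamma s := by
    intro n
    rw [← hval n]
    refine MeasureTheory.setIntegral_congr_fun measurableSet_Ioi fun y hy => ?_
    exact Real.norm_of_nonneg
      (mul_nonneg (Real.rpow_nonneg (le_of_lt hy) _) (Real.exp_pos _).le)
  have h := MeasureTheory.hasSum_integral_of_summable_integral_norm
    (μ := MeasureTheory.volume.restrict (Set.Ioi (0 : ℝ)))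
    (F := fun (n : ℕ) (y : ℝ) => y ^ (s - 1) * Real.exp (-((n : ℝ) + u) * y))
    (fun n => integrableOn_rpow_mul_exp_neg_mul (by linarith) (hb n))
    (by simp_rw [hnorm]; exact hsum)
  simp_rw [hval] at h
  have hcongr : ∫ y in Set.Ioi (0 : ℝ),
      y ^ (s - 1) * Real.exp (-u * y) * (1 / (Real.exp y - 1) + 1) =
      ∫ y in Set.Ioi (0 : ℝ), ∑' n : ℕ, y ^ (s - 1) * Real.exp (-((n : ℝ) + u) * y) := by
    refine MeasureTheory.setIntegral_congr_fun measurableSet_Ioi fun y hy => ?_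
    have hy : 0 < y := hy
    have hg := (hasSum_geometric_of_lt_one (Real.exp_pos (-y)).le
      (Real.exp_lt_one_iff.mpr (by linarith))).mul_left (y ^ (s - 1) * Real.exp (-u * y))
    have h1 : Real.exp y - 1 ≠ 0 := (sub_pos.mpr (Real.one_lt_exp_iff.mpr hy)).ne'
    -- The geometric series starts at `n = 0`, hence the extra `+ 1`.
    have e1 : (1 - Real.exp (-y))⁻¹ = 1 / (Real.exp y - 1) + 1 := by
      have h2 : 1 - Real.exp (-y) ≠ 0 :=
        (sub_pos.mpr (Real.exp_lt_one_iff.mpr (by linarith))).ne'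
      have h3 : Real.exp (-y) * Real.exp y = 1 := by rw [← Real.exp_add]; simp
      field_simp
      linear_combination h3
    rw [e1] at hg
    rw [← hg.tsum_eq]
    congr 1
    funext n
    rw [← Real.exp_nat_mul, mul_assoc, ← Real.exp_add]
    ring_nf
  rw [hcongr]
  refine (hc.mul_right _).unique ?_
  simpa using Complex.hasSum_ofReal.mpr h

/-- Justifies Fubini in Hermite's formula: `|sin(xy)| ≤ xy` cancels the singularity at `x = 0`,
leaving the product majorant `y^s e^(-uy) · e^(-πx)`. -/
theorem integrable_rpow_mul_exp_mul_sin_div_prod {s u : ℝ} (hs : 0 < s) (hu : 0 < u) :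
    MeasureTheory.Integrable (Function.uncurry fun y x : ℝ =>
        y ^ (s - 1) * Real.exp (-u * y) *
          (Real.sin (x * y) / (Real.exp (2 * Real.pi * x) - 1)))
      ((MeasureTheory.volume.restrict (Set.Ioi (0 : ℝ))).prod
        (MeasureTheory.volume.restrict (Set.Ioi (0 : ℝ)))) := by
  have hb := (integrableOn_rpow_mul_exp_neg_mul (s := s) (by linarith) hu).mul_prod
    (integrableOn_pow_mul_exp_neg_mul 0 Real.pi_pos)
  refine hb.mono' ?_ ?_
  · have : Measurable (Function.uncurry fun y x : ℝ =>
        y ^ (s - 1) * Real.exp (-u * y) *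
          (Real.sin (x * y) / (Real.exp (2 * Real.pi * x) - 1))) := by
      unfold Function.uncurry
      exact Measurable.mul (by fun_prop) (Measurable.div (by fun_prop) (by fun_prop))
    exact this.aestronglyMeasurable
  · rw [MeasureTheory.Measure.prod_restrict]
    filter_upwards [MeasureTheory.ae_restrict_mem (measurableSet_Ioi.prod measurableSet_Ioi)]
      with p hp
    obtain ⟨y, x⟩ := p
    have hy : 0 < y := hp.1
    have hx : 0 < x := hp.2
    have hE := exp_two_pi_mul_sub_one_pos hx
    have e : y ^ s = y ^ (s - 1) * y := by
      rw [← Real.rpow_add_one hy.ne']; ring_nf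
    simp only [Function.uncurry]
    rw [norm_mul, norm_mul, norm_div, Real.norm_of_nonneg hE.le,
      Real.norm_of_nonneg (Real.rpow_nonneg hy.le _), Real.norm_of_nonneg (Real.exp_pos _).le,
      Real.norm_eq_abs, e, pow_zero, one_mul]
    have hsin : |Real.sin (x * y)| ≤ x * y := by
      refine Real.abs_sin_le_abs.trans ?_
      rw [abs_of_pos (by positivity)]
    calc y ^ (s - 1) * Real.exp (-u * y) *
          (|Real.sin (x * y)| / (Real.exp (2 * Real.pi * x) - 1))
        ≤ y ^ (s - 1) * Real.exp (-u * y) * (x * y / (Real.exp (2 * Real.pi * x) - 1)) := by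
          gcongr
      _ = y ^ (s - 1) * y * Real.exp (-u * y) * (x / (Real.exp (2 * Real.pi * x) - 1)) := by ring
      _ ≤ _ := by gcongr; exact div_exp_sub_one_le hx

/-- Hermite's integral for the Hurwitz zeta function, for real `s > 1`. -/
theorem hurwitzZetaPos_eq_hermite {u s : ℝ} (hu : 0 < u) (hs : 1 < s) :
    hurwitzZetaPos s u =
      ((Real.exp (-s * Real.log u) / 2 + Real.exp (-(s - 1) * Real.log u) / (s - 1) +
        2 * ∫ x in Set.Ioi (0 : ℝ),
          Real.exp (-(s / 2) * Real.log (u ^ 2 + x ^ 2)) * Real.sin (s * Real.arctan (x / u)) /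
            (Real.exp (2 * Real.pi * x) - 1) : ℝ) : ℂ) := by
  have hs0 : 0 < s := by linarith
  have hs1 : 0 < s - 1 := by linarith
  have hG : 0 < Real.Gamma s := Real.Gamma_pos_of_pos hs0
  have hGs : Real.Gamma s = (s - 1) * Real.Gamma (s - 1) := by
    have := Real.Gamma_add_one hs1.ne'
    rwa [sub_add_cancel] at this
  have hI := integrable_rpow_mul_exp_mul_sin_div_prod hs0 hu
  have hswap := MeasureTheory.integral_integral_swap hI
  have hinner : ∀ x : ℝ, ∫ y in Set.Ioi (0 : ℝ), y ^ (s - 1) * Real.exp (-u * y) *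
      (Real.sin (x * y) / (Real.exp (2 * Real.pi * x) - 1)) =
      Real.exp (-(s / 2) * Real.log (u ^ 2 + x ^ 2)) * Real.sin (s * Real.arctan (x / u)) /
            (Real.exp (2 * Real.pi * x) - 1) * Real.Gamma s := by
    intro x
    simp_rw [← mul_div_assoc]
    rw [MeasureTheory.integral_div, integral_rpow_mul_exp_neg_mul_sin hs0 hu]
    ring
  simp_rw [hinner, MeasureTheory.integral_mul_const] at hswap
  have hi1 := integrableOn_rpow_mul_exp_neg_mul (s := s - 1) (by linarith) hu
  have hi2 := integrableOn_rpow_mul_exp_neg_mul (s := s - 1 - 1) (by linarith) hu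
  have hi3 := hI.integral_prod_left
  simp only [Function.uncurry] at hi3
  -- The three terms give `Γ(s)`, `Γ(s-1)` and the Hermite integral; the middle one converges at `0`
  -- because `s > 1`.
  have hsplit : ∫ y in Set.Ioi (0 : ℝ),
      y ^ (s - 1) * Real.exp (-u * y) * (1 / (Real.exp y - 1) + 1) =
      ∫ y in Set.Ioi (0 : ℝ), ((1 / 2) * (y ^ (s - 1) * Real.exp (-u * y)) +
        y ^ (s - 1 - 1) * Real.exp (-u * y) +
        2 * ∫ x in Set.Ioi (0 : ℝ), y ^ (s - 1) * Real.exp (-u * y) *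
          (Real.sin (x * y) / (Real.exp (2 * Real.pi * x) - 1))) := by
    refine MeasureTheory.setIntegral_congr_fun measurableSet_Ioi fun y hy => ?_
    have hy : 0 < y := hy
    have h1 := integral_sin_div_exp_sub_one hy
    have e : y ^ (s - 1 - 1) = y ^ (s - 1) * (1 / y) := by
      rw [Real.rpow_sub_one hy.ne']; ring
    rw [MeasureTheory.integral_const_mul, e]
    linear_combination (-(y ^ (s - 1) * Real.exp (-u * y))) * h1
  have hM := hurwitzZetaPos_mul_Gamma hu hs
  have hadd := MeasureTheory.integral_add ((hi1.const_mul (1 / 2)).add hi2) (hi3.const_mul 2)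
  simp only [Pi.add_apply] at hadd
  rw [hsplit, hadd, MeasureTheory.integral_add (hi1.const_mul _) hi2, MeasureTheory.integral_const_mul,
    MeasureTheory.integral_const_mul, hswap] at hM
  have hv : ∀ a : ℝ, 0 < a → ∫ y in Set.Ioi (0 : ℝ), y ^ (a - 1) * Real.exp (-u * y) =
      Real.exp (-a * Real.log u) * Real.Gamma a := by
    intro a ha
    have h := Real.integral_rpow_mul_exp_neg_mul_Ioi ha hu
    simp_rw [neg_mul]
    rw [h, one_div, Real.inv_rpow hu.le, ← Real.rpow_neg hu.le, Real.rpow_def_of_pos hu]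
    ring_nf
  rw [hv s hs0, hv (s - 1) hs1] at hM
  have hGc : (Real.Gamma s : ℂ) ≠ 0 := by exact_mod_cast hG.ne'
  refine mul_right_cancel₀ hGc ?_
  rw [hM, ← Complex.ofReal_mul, Complex.ofReal_inj]
  have e2 : Real.exp (-(s - 1) * Real.log u) / (s - 1) * Real.Gamma s =
      Real.exp (-(s - 1) * Real.log u) * Real.Gamma (s - 1) := by
    rw [hGs]; field_simp
  linear_combination -e2

/-! ### Bounds, and differentiation of the Hermite integral -/

theorem arctan_le_self_of_nonneg {y : ℝ} (hy : 0 ≤ y) : Real.arctan y ≤ y := by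
  have h := Real.le_tan (Real.arctan_nonneg.mpr hy) (Real.arctan_lt_pi_div_two y)
  rwa [Real.tan_arctan] at h

theorem abs_arctan_div_le {u x : ℝ} (hu : 0 < u) (hx : 0 < x) :
    |Real.arctan (x / u)| ≤ x / u := by
  have h : 0 ≤ x / u := by positivity
  rw [abs_of_nonneg (Real.arctan_nonneg.mpr h)]
  exact arctan_le_self_of_nonneg h

theorem two_mul_log_le_log_sq_add_sq {u : ℝ} (hu : 0 < u) (x : ℝ) :
    2 * Real.log u ≤ Real.log (u ^ 2 + x ^ 2) := by
  have h := Real.log_le_log (by positivity : 0 < u ^ 2) (by nlinarith : u ^ 2 ≤ u ^ 2 + x ^ 2)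
  rwa [Real.log_pow] at h

/-- From `u² + x² ≤ (u+x)²` and `log(1 + x/u) ≤ x/u`. Linear growth is what
`integrableOn_div_exp_sub_one` can absorb. -/
theorem log_sq_add_sq_le {u x : ℝ} (hu : 0 < u) (hx : 0 < x) :
    Real.log (u ^ 2 + x ^ 2) ≤ 2 * Real.log u + 2 * (x / u) := by
  have h1 : u ^ 2 + x ^ 2 ≤ (u * (1 + x / u)) ^ 2 := by
    have e : u * (1 + x / u) = u + x := by field_simp
    rw [e]; nlinarith
  have h2 := Real.log_le_log (by positivity : 0 < u ^ 2 + x ^ 2) h1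
  rw [Real.log_pow, Real.log_mul hu.ne' (by positivity)] at h2
  have h3 := Real.log_le_sub_one_of_pos (by positivity : 0 < 1 + x / u)
  push_cast at h2
  linarith

theorem abs_log_sq_add_sq_le {u x : ℝ} (hu : 0 < u) (hx : 0 < x) :
    |Real.log (u ^ 2 + x ^ 2)| ≤ 2 * |Real.log u| + 2 * (x / u) := by
  have h1 := two_mul_log_le_log_sq_add_sq hu x
  have h2 := log_sq_add_sq_le hu hx
  have h3 := abs_le.mp (le_refl |Real.log u|)
  have h4 : 0 < x / u := by positivity
  exact abs_le.mpr ⟨by linarith [h3.1], by linarith [h3.2]⟩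

theorem integrableOn_mul_log_div {u : ℝ} (hu : 0 < u) :
    MeasureTheory.IntegrableOn
      (fun x : ℝ => x * Real.log (u ^ 2 + x ^ 2) /
        ((u ^ 2 + x ^ 2) * (Real.exp (2 * Real.pi * x) - 1))) (Set.Ioi 0) := by
  simp_rw [← div_div]
  refine integrableOn_div_exp_sub_one (C := (2 * |Real.log u| + 2 / u) / u ^ 2)
    (Measurable.div (by fun_prop) (by fun_prop)) fun x hx => ?_
  have hA := abs_nonneg (Real.log u)
  rw [abs_div, abs_mul, abs_of_pos hx, abs_of_pos (by positivity : 0 < u ^ 2 + x ^ 2)]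
  calc x * |Real.log (u ^ 2 + x ^ 2)| / (u ^ 2 + x ^ 2)
      ≤ x * (2 * |Real.log u| + 2 * (x / u)) / u ^ 2 := by
        gcongr
        · exact abs_log_sq_add_sq_le hu hx
        · nlinarith
    _ ≤ x * ((2 * |Real.log u| + 2 / u) * (1 + x)) / u ^ 2 := by
        gcongr
        have e : 2 * (x / u) = 2 / u * x := by ring
        have : 0 < 2 / u := by positivity
        rw [e]; nlinarith
    _ = _ := by ring

theorem integrableOn_arctan_div {u : ℝ} (hu : 0 < u) :
    MeasureTheory.IntegrableOn
      (fun x : ℝ => Real.arctan (x / u) /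
        ((u ^ 2 + x ^ 2) * (Real.exp (2 * Real.pi * x) - 1))) (Set.Ioi 0) := by
  simp_rw [← div_div]
  refine integrableOn_div_exp_sub_one (C := 1 / u / u ^ 2)
    (Measurable.div (by fun_prop) (by fun_prop)) fun x hx => ?_
  rw [abs_div, abs_of_pos (by positivity : 0 < u ^ 2 + x ^ 2)]
  calc |Real.arctan (x / u)| / (u ^ 2 + x ^ 2) ≤ (x / u) / u ^ 2 := by
        gcongr
        · exact abs_arctan_div_le hu hx
        · nlinarith
    _ = 1 / u / u ^ 2 * (x * 1) := by ring
    _ ≤ 1 / u / u ^ 2 * (x * (1 + x)) := by gcongr; linarith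

theorem exp_neg_half_mul_log_le {u s : ℝ} (hu : 0 < u) (hs0 : 0 ≤ s) (hs2 : s ≤ 2) (x : ℝ) :
    Real.exp (-(s / 2) * Real.log (u ^ 2 + x ^ 2)) ≤ Real.exp (2 * |Real.log u|) := by
  rw [Real.exp_le_exp]
  have h1 := two_mul_log_le_log_sq_add_sq hu x
  have h2 := neg_abs_le (Real.log u)
  nlinarith [abs_nonneg (Real.log u)]

theorem abs_sin_mul_arctan_le {u s x : ℝ} (hu : 0 < u) (hs0 : 0 ≤ s) (hs2 : s ≤ 2) (hx : 0 < x) :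
    |Real.sin (s * Real.arctan (x / u))| ≤ 2 * (x / u) := by
  refine Real.abs_sin_le_abs.trans ?_
  rw [abs_mul, abs_of_nonneg hs0]
  have := abs_arctan_div_le hu hx
  gcongr

/-- The derivative at `s = 1` of Hermite's integral. -/
theorem hasDerivAt_hermite_integral {u : ℝ} (hu : 0 < u) :
    HasDerivAt (fun s : ℝ => ∫ x in Set.Ioi (0 : ℝ),
        Real.exp (-(s / 2) * Real.log (u ^ 2 + x ^ 2)) * Real.sin (s * Real.arctan (x / u)) /
          (Real.exp (2 * Real.pi * x) - 1))
      (u * (∫ x in Set.Ioi (0 : ℝ), Real.arctan (x / u) /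
          ((u ^ 2 + x ^ 2) * (Real.exp (2 * Real.pi * x) - 1))) -
        1 / 2 * ∫ x in Set.Ioi (0 : ℝ), x * Real.log (u ^ 2 + x ^ 2) /
          ((u ^ 2 + x ^ 2) * (Real.exp (2 * Real.pi * x) - 1))) 1 := by
  have hA := abs_nonneg (Real.log u)
  set F' : ℝ → ℝ → ℝ := fun s x =>
    (Real.exp (-(s / 2) * Real.log (u ^ 2 + x ^ 2)) * (-(1 / 2) * Real.log (u ^ 2 + x ^ 2)) *
        Real.sin (s * Real.arctan (x / u)) +
      Real.exp (-(s / 2) * Real.log (u ^ 2 + x ^ 2)) *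
        (Real.cos (s * Real.arctan (x / u)) * Real.arctan (x / u))) with hF'
  -- Collects the bounds on both terms of `F'` for `0 ≤ s ≤ 2`, a range containing the unit ball
  -- about `1`; each term carries a factor `x/u`, from the sine or the arctangent.
  set C : ℝ := Real.exp (2 * |Real.log u|) * (1 / u) * (2 * |Real.log u| + 1 + 2 / u) with hC
  have hbound : ∀ x : ℝ, 0 < x → ∀ s : ℝ, 0 ≤ s → s ≤ 2 → |F' s x| ≤ C * (x * (1 + x)) := by
    intro x hx s hs0 hs2
    have h1 := abs_log_sq_add_sq_le hu hx
    have h2 := exp_neg_half_mul_log_le hu hs0 hs2 x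
    have h3 := abs_sin_mul_arctan_le hu hs0 hs2 hx
    have h4 := abs_arctan_div_le hu hx
    have h5 := Real.abs_cos_le_one (s * Real.arctan (x / u))
    have h6 : 0 < x / u := by positivity
    calc |F' s x| ≤ Real.exp (2 * |Real.log u|) *
            ((1 / 2) * (2 * |Real.log u| + 2 * (x / u))) * (2 * (x / u)) +
          Real.exp (2 * |Real.log u|) * (1 * (x / u)) := by
          refine (abs_add_le _ _).trans ?_
          rw [abs_mul, abs_mul, abs_mul, abs_mul, abs_mul, Real.abs_exp, abs_neg,
            abs_of_pos (by norm_num : (0 : ℝ) < 1 / 2)]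
          gcongr
      _ = Real.exp (2 * |Real.log u|) * (1 / u) * x *
            (2 * |Real.log u| + 1 + 2 / u * x) := by ring
      _ ≤ Real.exp (2 * |Real.log u|) * (1 / u) * x *
            ((2 * |Real.log u| + 1 + 2 / u) * (1 + x)) := by
          gcongr
          have : 0 < 2 / u := by positivity
          nlinarith
      _ = C * (x * (1 + x)) := by rw [hC]; ring
  have hC0 : 0 ≤ C := by positivity
  have hmeasF : ∀ s : ℝ, Measurable fun x : ℝ =>
      Real.exp (-(s / 2) * Real.log (u ^ 2 + x ^ 2)) * Real.sin (s * Real.arctan (x / u)) := by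
    intro s; fun_prop
  have hmeasF' : Measurable (F' 1) := by
    rw [hF']; fun_prop
  have hE : Measurable fun x : ℝ => Real.exp (2 * Real.pi * x) - 1 := by fun_prop
  have hint : MeasureTheory.IntegrableOn (fun x : ℝ =>
      Real.exp (-((1 : ℝ) / 2) * Real.log (u ^ 2 + x ^ 2)) *
        Real.sin ((1 : ℝ) * Real.arctan (x / u)) / (Real.exp (2 * Real.pi * x) - 1))
      (Set.Ioi 0) := by
    refine integrableOn_div_exp_sub_one (C := Real.exp (2 * |Real.log u|) * (2 / u))
      (hmeasF 1) fun x hx => ?_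
    rw [abs_mul, Real.abs_exp]
    calc _ ≤ Real.exp (2 * |Real.log u|) * (2 * (x / u)) := by
          exact mul_le_mul (exp_neg_half_mul_log_le hu zero_le_one one_le_two x)
            (abs_sin_mul_arctan_le hu zero_le_one one_le_two hx) (abs_nonneg _)
            (Real.exp_pos _).le
      _ = Real.exp (2 * |Real.log u|) * (2 / u) * (x * 1) := by ring
      _ ≤ _ := by gcongr; linarith
  have hbi : MeasureTheory.IntegrableOn
      (fun x : ℝ => C * (x * (1 + x)) / (Real.exp (2 * Real.pi * x) - 1)) (Set.Ioi 0) := by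
    refine integrableOn_div_exp_sub_one (C := C) (by fun_prop) fun x hx => ?_
    rw [abs_of_nonneg (by positivity)]
  have key := (hasDerivAt_integral_of_dominated_loc_of_deriv_le
    (μ := MeasureTheory.volume.restrict (Set.Ioi (0 : ℝ))) (x₀ := (1 : ℝ))
    (F := fun s x => Real.exp (-(s / 2) * Real.log (u ^ 2 + x ^ 2)) *
      Real.sin (s * Real.arctan (x / u)) / (Real.exp (2 * Real.pi * x) - 1))
    (F' := fun s x => F' s x / (Real.exp (2 * Real.pi * x) - 1))
    (Metric.ball_mem_nhds (1 : ℝ) one_pos)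
    (Eventually.of_forall fun s => ((hmeasF s).div hE).aestronglyMeasurable) hint
    (hmeasF'.div hE).aestronglyMeasurable
    (by
      filter_upwards [MeasureTheory.ae_restrict_mem measurableSet_Ioi] with x hx s hs
      have hx : 0 < x := hx
      have hEx := exp_two_pi_mul_sub_one_pos hx
      rw [Metric.mem_ball, Real.dist_eq, abs_lt] at hs
      rw [Real.norm_eq_abs, abs_div, abs_of_pos hEx]
      have := hbound x hx s (by linarith [hs.1]) (by linarith [hs.2])
      gcongr)
    hbi
    (by
      refine Eventually.of_forall fun x s _ => ?_
      have h1 : HasDerivAt (fun s : ℝ => -(s / 2) * Real.log (u ^ 2 + x ^ 2))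
          (-(1 / 2) * Real.log (u ^ 2 + x ^ 2)) s :=
        (((hasDerivAt_id s).div_const 2).neg).mul_const _
      have h2 : HasDerivAt (fun s : ℝ => s * Real.arctan (x / u)) (Real.arctan (x / u)) s := by
        simpa using (hasDerivAt_id s).mul_const (Real.arctan (x / u))
      exact (h1.exp.mul h2.sin).div_const _)).2
  convert! key using 1
  rw [← MeasureTheory.integral_const_mul, ← MeasureTheory.integral_const_mul,
    ← MeasureTheory.integral_sub ((integrableOn_arctan_div hu).const_mul u)
      ((integrableOn_mul_log_div hu).const_mul (1 / 2))]
  congr 1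
  funext x
  have hr : 0 < u ^ 2 + x ^ 2 := by positivity
  have hsq : Real.sqrt (u ^ 2 + x ^ 2) ≠ 0 := (Real.sqrt_pos.mpr hr).ne'
  have hexp : Real.exp (-(1 / 2) * Real.log (u ^ 2 + x ^ 2)) = 1 / Real.sqrt (u ^ 2 + x ^ 2) := by
    rw [neg_mul, Real.exp_neg, one_div_mul_eq_div, ← Real.log_sqrt hr.le,
      Real.exp_log (Real.sqrt_pos.mpr hr), one_div]
  have hsqrt : Real.sqrt (1 + (x / u) ^ 2) = Real.sqrt (u ^ 2 + x ^ 2) / u := by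
    rw [show 1 + (x / u) ^ 2 = (u ^ 2 + x ^ 2) / u ^ 2 by field_simp,
      Real.sqrt_div hr.le, Real.sqrt_sq hu.le]
  -- At `s = 1` the sine and cosine of `arctan(x/u)` are `x/√(u²+x²)` and `u/√(u²+x²)`, so all
  -- square roots pair up.
  have hnum : F' 1 x = (u * Real.arctan (x / u) - 1 / 2 * (x * Real.log (u ^ 2 + x ^ 2))) /
      (u ^ 2 + x ^ 2) := by
    simp only [hF']
    rw [hexp, one_mul, Real.sin_arctan, Real.cos_arctan, hsqrt]
    generalize Real.arctan (x / u) = θ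
    generalize Real.log (u ^ 2 + x ^ 2) = L
    have hs2 := Real.sq_sqrt hr.le
    generalize Real.sqrt (u ^ 2 + x ^ 2) = r at *
    rw [← hs2]
    field_simp
    ring
  rw [hnum]
  simp only [← mul_div_assoc, div_div, sub_div]

/-! ### Removing the pole and evaluating at `s = 1` -/

/-- Cubic Taylor remainder of `exp`: `(e^t - 1)/t = 1 + t/2 + O(t²)`. -/
theorem hasDerivAt_dslope_exp_zero : HasDerivAt (dslope Real.exp 0) (1 / 2) 0 := by
  rw [hasDerivAt_iff_isLittleO_nhds_zero]
  have h := Real.exp_sub_sum_range_isBigO_pow 3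
  obtain ⟨C, hC⟩ := h.bound
  have hO : (fun h : ℝ => dslope Real.exp 0 (0 + h) - dslope Real.exp 0 0 - h • (1 / 2 : ℝ))
      =O[𝓝 0] fun h : ℝ => h ^ 2 := by
    refine Asymptotics.IsBigO.of_bound C ?_
    filter_upwards [hC] with t ht
    by_cases h0 : t = 0
    · simp [h0]
    rw [zero_add, dslope_of_ne _ h0, dslope_same, Real.deriv_exp, slope_def_field, Real.exp_zero]
    simp only [Finset.sum_range_succ, Finset.sum_range_zero] at ht
    have e : (Real.exp t - 1) / (t - 0) - 1 - t • (1 / 2 : ℝ) =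
        (Real.exp t - (1 + t + t ^ 2 / 2)) / t := by
      rw [smul_eq_mul]; field_simp; ring
    rw [e, norm_div, div_le_iff₀ (norm_pos_iff.mpr h0)]
    have e2 : C * ‖t ^ 2‖ * ‖t‖ = C * ‖t ^ 3‖ := by simp only [norm_pow]; ring
    rw [e2]
    convert! ht using 3
    norm_num [Nat.factorial]
  exact hO.trans_isLittleO (Asymptotics.isLittleO_pow_id one_lt_two)

/-- Continuity extends the equality to `a` itself; then the right derivatives at `a` coincide. -/
theorem hasDerivAt_unique_of_eqOn_Ioi {f g : ℝ → ℂ} {f' g' : ℂ} {a : ℝ}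
    (hf : HasDerivAt f f' a) (hg : HasDerivAt g g' a) (h : Set.EqOn f g (Set.Ioi a)) :
    f' = g' := by
  have hev : f =ᶠ[𝓝[>] a] g := eventually_mem_nhdsWithin.mono fun x hx => h hx
  have ha : f a = g a := tendsto_nhds_unique
    ((hf.continuousAt.tendsto.mono_left nhdsWithin_le_nhds).congr' hev)
    (hg.continuousAt.tendsto.mono_left nhdsWithin_le_nhds)
  exact (uniqueDiffWithinAt_Ioi a).eq_deriv _ hf.hasDerivWithinAt
    (hg.hasDerivWithinAt.congr_of_eventuallyEq hev ha)

/-- Writing `(u^(1-s)-1)/(s-1)` through `dslope` gives a right side that is differentiable at `s =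
1`. -/
theorem hurwitzZetaRegular_eq_hermite {u s : ℝ} (hu : 0 < u) (hs : 1 < s) :
    hurwitzZetaRegular u s =
      ((Real.exp (-s * Real.log u) / 2 +
        -Real.log u * dslope Real.exp 0 (-Real.log u * (s - 1)) +
        2 * ∫ x in Set.Ioi (0 : ℝ),
          Real.exp (-(s / 2) * Real.log (u ^ 2 + x ^ 2)) * Real.sin (s * Real.arctan (x / u)) /
            (Real.exp (2 * Real.pi * x) - 1) : ℝ) : ℂ) := by
  have hs1 : s - 1 ≠ 0 := (sub_pos.mpr hs).ne'
  have hne : (s : ℂ) ≠ 1 := by exact_mod_cast hs.ne'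
  have e : -Real.log u * dslope Real.exp 0 (-Real.log u * (s - 1)) =
      Real.exp (-(s - 1) * Real.log u) / (s - 1) - 1 / (s - 1) := by
    -- For `u = 1` the `dslope` sits at its base point, but its coefficient vanishes.
    by_cases h0 : Real.log u = 0
    · simp [h0]
    rw [dslope_of_ne _ (mul_ne_zero (neg_ne_zero.mpr h0) hs1), slope_def_field, Real.exp_zero,
      show -Real.log u * (s - 1) = -(s - 1) * Real.log u by ring]
    field_simp
    ring
  rw [hurwitzZetaRegular, Function.update_of_ne hne, hurwitzZetaPos_eq_hermite hu hs, e]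
  push_cast
  ring

theorem mainTheorem5 (u : ℝ) (hu : 0 < u) :
    MeasureTheory.IntegrableOn
      (fun x : ℝ => x * Real.log (u ^ 2 + x ^ 2) /
        ((u ^ 2 + x ^ 2) * (Real.exp (2 * Real.pi * x) - 1))) (Set.Ioi 0) ∧
    MeasureTheory.IntegrableOn
      (fun x : ℝ => Real.arctan (x / u) /
        ((u ^ 2 + x ^ 2) * (Real.exp (2 * Real.pi * x) - 1))) (Set.Ioi 0) ∧
    stieltjesGamma 1 u =
      ((1 / (2 * u) * Real.log u - 1 / 2 * Real.log u ^ 2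
        + (∫ x in Set.Ioi (0 : ℝ), x * Real.log (u ^ 2 + x ^ 2) /
            ((u ^ 2 + x ^ 2) * (Real.exp (2 * Real.pi * x) - 1)))
        - 2 * u * (∫ x in Set.Ioi (0 : ℝ), Real.arctan (x / u) /
            ((u ^ 2 + x ^ 2) * (Real.exp (2 * Real.pi * x) - 1))) : ℝ) : ℂ) := by
  refine ⟨integrableOn_mul_log_div hu, integrableOn_arctan_div hu, ?_⟩
  have hF : HasDerivAt (fun s : ℝ => hurwitzZetaRegular u s) (deriv (hurwitzZetaRegular u) 1) 1 := by
    have h := (differentiable_hurwitzZetaRegular hu ((1 : ℝ) : ℂ)).hasDerivAt.comp_ofReal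
    rwa [Complex.ofReal_one] at h
  have h1 : HasDerivAt (fun s : ℝ => Real.exp (-s * Real.log u) / 2)
      (Real.exp (-1 * Real.log u) * (-1 * Real.log u) / 2) 1 :=
    (((hasDerivAt_id (1 : ℝ)).neg.mul_const _).exp).div_const 2
  have h2 : HasDerivAt (fun s : ℝ => -Real.log u * dslope Real.exp 0 (-Real.log u * (s - 1)))
      (-Real.log u * (1 / 2 * (-Real.log u * 1))) 1 := by
    have hin : HasDerivAt (fun s : ℝ => -Real.log u * (s - 1)) (-Real.log u * 1) 1 :=
      ((hasDerivAt_id (1 : ℝ)).sub_const 1).const_mul _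
    refine (HasDerivAt.comp (1 : ℝ) ?_ hin).const_mul _
    rw [sub_self, mul_zero]
    exact hasDerivAt_dslope_exp_zero
  have hG := ((h1.add h2).add ((hasDerivAt_hermite_integral hu).const_mul 2)).ofReal_comp
  have hD := hasDerivAt_unique_of_eqOn_Ioi hF hG
    fun s hs => hurwitzZetaRegular_eq_hermite hu hs
  have hexp : Real.exp (-1 * Real.log u) = 1 / u := by
    rw [neg_one_mul, Real.exp_neg, Real.exp_log hu, one_div]
  rw [stieltjesGamma, iteratedDeriv_one, hD, pow_one, neg_one_mul, ← Complex.ofReal_neg,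
    Complex.ofReal_inj, hexp]
  ring
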